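/- **Corollary 4.11.** All codes are binary linear codes, $C^\perp$ is the dual for the Euclidean inner product, and $C_2\subset C_1\subset\mathbb F_2^n$ form a *CSS-T pair* $(C_1,C_2)$ if every word of $C_2$ has even weight and, for every $x\in C_2$, the shortening of $C_1^\perp$ in the set $Z(x)$ of zero coordinates of $x$ contains a self-dual code. CSS-T pairs are ordered by $(C_1,C_2)\le(C_1',C_2')$ iff $C_1\subset C_1'$ and $C_2\subset C_2'$. A CSS-T pair $(C_1,C_2)$ is *maximal* if it is a maximal element of this poset, *maximal in $C_1$* if $(C_1,C_2)\le(C_1',C_2)$ with $(C_1',C_2)$ a CSS-T pair implies $C_1'=C_1$, and *maximal in $C_2$* if $(C_1,C_2)\le(C_1,C_2')$ with $(C_1,C_2')$ a CSS-T pair implies $C_2'=C_2$. (For $C_2\neq\{0\}$ these notions do not change if the trivial pairs $(D,\{0\})$ are discarded from the poset.) Let $s>1$, let $n\mid 2^s-1$, and let $\beta\in\mathbb F_{2^s}$ be a primitive $n$-th root of unity. Write $\mathbb Z_n=\mathbb Z/n\mathbb Z$. For $I,I'\subset\mathbb Z_n$ put $-I=\{-i: i\in I\}$ and $I+I'=\{i+i'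 : i\in I,\ i'\in I'\}$; $I$ is called a *cyclotomic coset* if $I=2\cdot I$. For $I\subset\mathbb Z_n$ let $$C(I)=\left\{(f(1),f(\beta),\dots,f(\beta^{n-1})) : f\in\langle x^i : i\in -I\rangle_{\mathbb F_{2^s}}\right\}\cap\mathbb F_2^n .$$ Let $I_1,I_2\subset\mathbb Z_n$ be cyclotomic cosets such that $(C(I_1),C(I_2))$ is a CSS-T pair, and let $J_i=\mathbb Z_n\setminus I_i$ for $i=1,2$. Then the pair $(C_1,C_2)=(C(I_1),C(I_2))$ - is maximal in $C_1$ if and only if $-J_1=I_2\cup(I_1+I_2)$; - is maximal in $C_2$ if and only if $-J_2=(-J_1)\cup(I_1+I_1)$; - is maximal if and only if $-J_1=I_1+I_2$ and $-J_2=I_1+I_1$. -/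

import Mathlib

open scoped Pointwise Polynomial

/-! ## Binary linear codes -/

section Codes

variable {ι : Type*} [Fintype ι]

/-- The dual `C^⊥` of a binary code `C ⊆ 𝔽₂^ι` for the Euclidean inner product. -/
def dualCode (C : Submodule (ZMod 2) (ι → ZMod 2)) : Submodule (ZMod 2) (ι → ZMod 2) where
  carrier := {y | ∀ x ∈ C, x ⬝ᵥ y = 0}
  zero_mem' := fun x _ => dotProduct_zero x
  add_mem' := fun {a b} ha hb x hx => by rw [dotProduct_add, ha x hx, hb x hx, add_zero]
  smul_mem' := fun c a ha x hx => by rw [dotProduct_smul, ha x hx, smul_zero]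

/-- A code is self-dual if it is equal to its dual. -/
def IsSelfDual (C : Submodule (ZMod 2) (ι → ZMod 2)) : Prop :=
  dualCode C = C

/-- A code is even-weighted if all its codewords have even Hamming weight. -/
def IsEvenWeighted (C : Submodule (ZMod 2) (ι → ZMod 2)) : Prop :=
  ∀ c ∈ C, Even (hammingNorm c)

variable [DecidableEq ι]

/-- The shortening `C_S` of `C` in the coordinates of `S`: keep the codewords of `C` that vanish
on `S` and delete the coordinates in `S`. Equivalently, `C_S` consists of the words on the
complement of `S` whose extension by zero lies in `C`. -/
noncomputable def shortening (C : Submodule (ZMod 2) (ι → ZMod 2)) (S : Finset ι) :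
    Submodule (ZMod 2) ({i // i ∉ S} → ZMod 2) :=
  C.comap (Function.ExtendByZero.linearMap (ZMod 2) (Subtype.val : {i // i ∉ S} → ι))

/-- The set `Z(x)` of the zero coordinates of `x`. -/
def zeroCoords (x : ι → ZMod 2) : Finset ι :=
  Finset.univ.filter fun i => x i = 0

/-- `(C₁, C₂)` is a CSS-T pair: `C₂ ⊆ C₁`, `C₂` is even-weighted, and for every `x ∈ C₂` the
shortening of `C₁^⊥` in `Z(x)` contains a self-dual code (of length the weight of `x`). -/
def IsCSSTPair (C₁ C₂ : Submodule (ZMod 2) (ι → ZMod 2)) : Prop :=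
  C₂ ≤ C₁ ∧ IsEvenWeighted C₂ ∧
    ∀ x ∈ C₂, ∃ D : Submodule (ZMod 2) ({i // i ∉ zeroCoords x} → ZMod 2),
      IsSelfDual D ∧ D ≤ shortening (dualCode C₁) (zeroCoords x)

/-- `(C₁, C₂)` is a CSS-T pair that is maximal in `C₁`: no CSS-T pair `(C₁', C₂)` has
`C₁ ⊊ C₁'`. -/
def IsMaximalInFst (C₁ C₂ : Submodule (ZMod 2) (ι → ZMod 2)) : Prop :=
  Maximal (fun D₁ => IsCSSTPair D₁ C₂) C₁

/-- `(C₁, C₂)` is a CSS-T pair that is maximal in `C₂`: no CSS-T pair `(C₁, C₂')` has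
`C₂ ⊊ C₂'`. -/
def IsMaximalInSnd (C₁ C₂ : Submodule (ZMod 2) (ι → ZMod 2)) : Prop :=
  Maximal (fun D₂ => IsCSSTPair C₁ D₂) C₂

/-- `(C₁, C₂)` is a maximal element of the poset of CSS-T pairs, ordered by componentwise
inclusion. (Every pair above a pair with `C₂ ≠ 0` has nonzero second component, so for pairs with
`C₂ ≠ 0` it makes no difference, here and in the two definitions above, whether the trivial pairs
`(D, 0)` are discarded from the poset; see `isMaximalCSSTPair_iff_of_ne_bot`.) -/
def IsMaximalCSSTPair (C₁ C₂ : Submodule (ZMod 2) (ι → ZMod 2)) : Prop :=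
  Maximal (fun p : Submodule (ZMod 2) (ι → ZMod 2) × Submodule (ZMod 2) (ι → ZMod 2) =>
    IsCSSTPair p.1 p.2) (C₁, C₂)

/-- For `C₂ ≠ 0`, discarding the trivial pairs `(D, 0)` does not affect maximality. -/
theorem isMaximalCSSTPair_iff_of_ne_bot {C₁ C₂ : Submodule (ZMod 2) (ι → ZMod 2)}
    (h : C₂ ≠ ⊥) :
    IsMaximalCSSTPair C₁ C₂ ↔
      Maximal (fun p : Submodule (ZMod 2) (ι → ZMod 2) × Submodule (ZMod 2) (ι → ZMod 2) =>
        IsCSSTPair p.1 p.2 ∧ p.2 ≠ ⊥) (C₁, C₂) :=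
  ⟨fun H => ⟨⟨H.1, h⟩, fun _ hq hle => H.2 hq.1 hle⟩,
    fun H => ⟨H.1.1, fun _ hq hle => H.2 ⟨hq, fun h0 => h (le_bot_iff.mp (h0 ▸ hle.2))⟩ hle⟩⟩

end Codes

/-! ## Cyclic codes as subfield subcodes of evaluation codes -/

section Cyclic

/-- `I ⊆ ℤ/nℤ` is a (binary) cyclotomic coset if `I = 2 · I`. -/
def IsCyclotomicCoset {n : ℕ} (I : Set (ZMod n)) : Prop :=
  I = (fun i => 2 * i) '' I

variable {K : Type*} [Field K]

/-- `ℒ(M)`, the `K`-linear span of the monomials `x^i` with `i ∈ M`. -/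
noncomputable def monomialSpan (K : Type*) [Field K] (M : Set ℕ) : Submodule K K[X] :=
  Submodule.span K ((fun i : ℕ => (Polynomial.X : K[X]) ^ i) '' M)

/-- The evaluation map `f ↦ (f(1), f(β), …, f(β^(n-1)))`. -/
noncomputable def evalPowers (n : ℕ) (β : K) : K[X] →ₗ[K] (Fin n → K) :=
  LinearMap.pi fun k => Polynomial.leval (β ^ (k : ℕ))

/-- The evaluation code `B(M) = ev(ℒ(M)) ⊆ K^n`. -/
noncomputable def evalCode (n : ℕ) (β : K) (M : Set ℕ) : Submodule K (Fin n → K) :=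
  (monomialSpan K M).map (evalPowers n β)

/-- The binary cyclic code `C(I) = B(-I) ∩ 𝔽₂^n`. The elements of `-I ⊆ ℤ/nℤ` enter as exponents
through their representatives in `{0, …, n-1}`; the choice of representatives does not matter when
`β^n = 1`. -/
noncomputable def cyclicCode [Algebra (ZMod 2) K] {n : ℕ} (β : K) (I : Set (ZMod n)) :
    Submodule (ZMod 2) (Fin n → ZMod 2) :=
  ((evalCode n β (ZMod.val '' (-I))).restrictScalars (ZMod 2)).comap
    ((Algebra.linearMap (ZMod 2) K).compLeft (Fin n))

end Cyclic

/-!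
A pair `C₂ ⊆ C₁` is a CSS-T pair iff `∑ x_k c_k c'_k = 0` for all `x ∈ C₂` and `c, c' ∈ C₁`
(`isCSSTPair_iff`): a binary code of even length lies in a self-dual code as soon as it is
self-orthogonal. This condition is linear in each factor, and `c * c = c`, so words can be adjoined
one at a time: the pair is maximal in `C₁` iff `C₂^⊥ ∩ (C₁ * C₂)^⊥ ⊆ C₁`, and maximal in `C₂` iff
`C₁ ∩ (C₁ * C₁)^⊥ ⊆ C₂`. It is maximal iff it is maximal in both components.

For cyclic codes the Fourier transform `j ↦ ∑ v_k β^(jk)` turns these conditions into conditions on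
subsets of `ℤ/nℤ`. On the one hand `C(I)` consists of the words whose transform vanishes off `I`
(`mem_cyclicCode_iff`). On the other hand, if `I = 2I`, the trace words `k ↦ Tr(a β^(ik))` with
`i ∈ -I` lie in `C(I)`, so that `C(I)` spans over `K` the whole evaluation code of `-I`
(`forall_mem_cyclicCode`). Hence inclusions of codes are inclusions of sets, `C(M)^⊥ = C((-M)ᶜ)`,
and `C(I) * C(J)` has the same dual as `C(I + J)`. What remains is set algebra
(`maximal_sets_iff`).
-/

/-! ### CSS-T pairs and triple products -/

section Codes

variable {ι : Type*} [Fintype ι]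

theorem ZMod.mul_self_of_two (a : ZMod 2) : a * a = a := by
  revert a; decide

/-- Every binary word `x` satisfies `x ⬝ x = x ⬝ 1`, so a maximal self-orthogonal code of even
length contains the all-ones word, and then its dual is self-orthogonal as well. -/
theorem exists_isSelfDual_ge (hι : (Fintype.card ι : ZMod 2) = 0)
    (C : Submodule (ZMod 2) (ι → ZMod 2)) (hC : C ≤ dualCode C) :
    ∃ D, C ≤ D ∧ IsSelfDual D := by
  classical
  obtain ⟨D, hCD, hD⟩ := Set.Finite.exists_le_maximal
    (Set.toFinite {D : Submodule (ZMod 2) (ι → ZMod 2) | D ≤ dualCode D}) hC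
  refine ⟨D, hCD, le_antisymm ?_ hD.1⟩
  have self (x : ι → ZMod 2) : x ⬝ᵥ x = x ⬝ᵥ 1 := by
    simp [dotProduct, ZMod.mul_self_of_two]
  -- A self-orthogonal word of the dual can be adjoined to `D`, so it lies in `D`.
  have adjoin (v : ι → ZMod 2) (hv : v ∈ dualCode D) (hvv : v ⬝ᵥ v = 0) : v ∈ D := by
    have key : D ⊔ Submodule.span (ZMod 2) {v} ≤ dualCode (D ⊔ Submodule.span (ZMod 2) {v}) := by
      intro y hy x hx
      obtain ⟨d, hd, w, hw, rfl⟩ := Submodule.mem_sup.1 hy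
      obtain ⟨d', hd', w', hw', rfl⟩ := Submodule.mem_sup.1 hx
      obtain ⟨a, rfl⟩ := Submodule.mem_span_singleton.1 hw
      obtain ⟨a', rfl⟩ := Submodule.mem_span_singleton.1 hw'
      have h1 : d' ⬝ᵥ d = 0 := hD.1 hd d' hd'
      have h2 : d' ⬝ᵥ v = 0 := hv d' hd'
      have h3 : v ⬝ᵥ d = 0 := by rw [dotProduct_comm]; exact hv d hd
      simp [h1, h2, h3, hvv]
    exact hD.2 key le_sup_left (Submodule.mem_sup_right (Submodule.mem_span_singleton_self v))
  have one_mem : (1 : ι → ZMod 2) ∈ D := by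
    refine adjoin 1 (fun x hx => ?_) ?_
    · rw [← self]; exact hD.1 hx x hx
    · simpa [dotProduct] using hι
  intro x hx
  refine adjoin x hx ?_
  rw [self, dotProduct_comm]
  exact hx 1 one_mem

theorem natCast_hammingNorm (x : ι → ZMod 2) : (hammingNorm x : ZMod 2) = ∑ i, x i := by
  have h : ∀ a : ZMod 2, a = if a ≠ 0 then 1 else 0 := by decide
  rw [hammingNorm, Finset.card_filter, Nat.cast_sum]
  refine Finset.sum_congr rfl fun i _ => ?_
  conv_rhs => rw [h (x i)]
  split_ifs <;> simp

variable [DecidableEq ι]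

theorem sum_compl_zeroCoords (x c : ι → ZMod 2) :
    ∑ i : {i // i ∉ zeroCoords x}, c i = ∑ i, x i * c i := by
  have h : ∀ a b : ZMod 2, a * b = if a ≠ 0 then b else 0 := by decide
  rw [Finset.sum_congr rfl fun i _ => h (x i) (c i), ← Finset.sum_filter]
  exact (Finset.sum_subtype _ (by simp [zeroCoords]) c).symm

theorem mem_shortening_dualCode {C : Submodule (ZMod 2) (ι → ZMod 2)} {S : Finset ι}
    {d : {i // i ∉ S} → ZMod 2} :
    d ∈ shortening (dualCode C) S ↔ ∀ c ∈ C, (fun i : {i // i ∉ S} => c i) ⬝ᵥ d = 0 := by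
  refine forall₂_congr fun c _ => ?_
  have : c ⬝ᵥ Function.ExtendByZero.linearMap (ZMod 2) (Subtype.val : {i // i ∉ S} → ι) d
      = (fun i : {i // i ∉ S} => c i) ⬝ᵥ d := by
    have hext (i : {i // i ∉ S}) : Function.extend (Subtype.val : {i // i ∉ S} → ι) d 0 i = d i :=
      Subtype.val_injective.extend_apply _ _ _
    have h0 (i : ι) (hi : ¬ i ∉ S) : c i * Function.extend (Subtype.val : {i // i ∉ S} → ι) d 0 i
        = 0 := by
      rw [Function.extend_apply' _ _ _ (by rintro ⟨a, rfl⟩; exact hi a.2)]; simp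
    simp only [dotProduct, Function.ExtendByZero.linearMap_apply]
    rw [← Finset.sum_subset (Finset.filter_subset (fun i => i ∉ S) Finset.univ)
      (fun i _ hi => h0 i (by simpa using hi)),
      Finset.sum_subtype (p := fun i => i ∉ S) (F := inferInstance) _ (by simp)]
    simp only [hext]
  rw [this]

/-- The shortening of `C₁^⊥` at `Z(x)` is the dual of the puncturing `R` of `C₁` to the support
of `x`. It contains a self-dual code exactly when `R` lies in one, that is, when `R` is
self-orthogonal. The even weight of `x` is the case where all three factors are `x`. -/
theorem isCSSTPair_iff {C₁ C₂ : Submodule (ZMod 2) (ι → ZMod 2)} :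
    IsCSSTPair C₁ C₂ ↔
      C₂ ≤ C₁ ∧ ∀ x ∈ C₂, ∀ c ∈ C₁, ∀ c' ∈ C₁, ∑ i, x i * (c i * c' i) = 0 := by
  constructor
  · rintro ⟨hle, -, h⟩
    refine ⟨hle, fun x hx c hc c' hc' => ?_⟩
    obtain ⟨D, hD, hDs⟩ := h x hx
    have mem (c) (hc : c ∈ C₁) : (fun i : {i // i ∉ zeroCoords x} => c i) ∈ D := by
      rw [← hD]
      intro d hd
      rw [dotProduct_comm]
      exact mem_shortening_dualCode.1 (hDs hd) c hc
    rw [← sum_compl_zeroCoords x fun i => c i * c' i]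
    exact mem_shortening_dualCode.1 (hDs (mem c' hc')) c hc
  · rintro ⟨hle, h⟩
    have even (x) (hx : x ∈ C₂) : ∑ i, x i = 0 := by
      simpa [ZMod.mul_self_of_two] using h x hx x (hle hx) x (hle hx)
    refine ⟨hle, fun x hx => ?_, fun x hx => ?_⟩
    · rw [← ZMod.natCast_eq_zero_iff_even, natCast_hammingNorm, even x hx]
    · obtain ⟨D, hRD, hD⟩ := exists_isSelfDual_ge (ι := {i // i ∉ zeroCoords x})
        (by simpa [even x hx] using sum_compl_zeroCoords x 1)
        (C₁.map (LinearMap.funLeft (ZMod 2) (ZMod 2) Subtype.val)) (by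
          rintro _ ⟨c, hc, rfl⟩ _ ⟨c', hc', rfl⟩
          exact (sum_compl_zeroCoords x fun i => c' i * c i).trans (h x hx c' hc' c hc))
      refine ⟨D, hD, fun d hd => mem_shortening_dualCode.2 fun c hc => ?_⟩
      rw [← hD] at hd
      exact hd _ (hRD (Submodule.mem_map_of_mem hc))

theorem IsCSSTPair.mono {C₁ C₂ D₁ D₂ : Submodule (ZMod 2) (ι → ZMod 2)} (h : IsCSSTPair D₁ D₂)
    (h₁ : C₁ ≤ D₁) (h₂ : C₂ ≤ D₂) (hle : C₂ ≤ C₁) : IsCSSTPair C₁ C₂ := by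
  rw [isCSSTPair_iff] at h ⊢
  exact ⟨hle, fun x hx c hc c' hc' => h.2 x (h₂ hx) c (h₁ hc) c' (h₁ hc')⟩

/-- `(C₁, C₂)` is maximal in `C₁` iff `C₁` contains `C₂^⊥ ∩ (C₁ * C₂)^⊥`. -/
theorem isMaximalInFst_iff {C₁ C₂ : Submodule (ZMod 2) (ι → ZMod 2)} (h : IsCSSTPair C₁ C₂) :
    IsMaximalInFst C₁ C₂ ↔ ∀ v, (∀ x ∈ C₂, ∑ i, x i * v i = 0) →
      (∀ x ∈ C₂, ∀ c ∈ C₁, ∑ i, x i * (c i * v i) = 0) → v ∈ C₁ := by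
  obtain ⟨hle, h3⟩ := isCSSTPair_iff.1 h
  constructor
  · intro hmax v hv hcv
    refine hmax.2 (y := C₁ ⊔ Submodule.span (ZMod 2) {v}) (isCSSTPair_iff.2
      ⟨hle.trans le_sup_left, fun x hx y hy y' hy' => ?_⟩) le_sup_left
      (Submodule.mem_sup_right (Submodule.mem_span_singleton_self v))
    obtain ⟨c, hc, w, hw, rfl⟩ := Submodule.mem_sup.1 hy
    obtain ⟨c', hc', w', hw', rfl⟩ := Submodule.mem_sup.1 hy'
    obtain ⟨a, rfl⟩ := Submodule.mem_span_singleton.1 hw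
    obtain ⟨a', rfl⟩ := Submodule.mem_span_singleton.1 hw'
    have expand (i : ι) : x i * ((c + a • v) i * (c' + a' • v) i) =
        x i * (c i * c' i) + a' * (x i * (c i * v i)) + a * (x i * (c' i * v i))
          + a * a' * (x i * v i) := by
      simp only [Pi.add_apply, Pi.smul_apply, smul_eq_mul]
      linear_combination (a * a' * x i) * ZMod.mul_self_of_two (v i)
    simp only [expand, Finset.sum_add_distrib, ← Finset.mul_sum, h3 x hx c hc c' hc',
      hcv x hx c hc, hcv x hx c' hc', hv x hx, mul_zero, add_zero]
  · intro H
    refine ⟨h, fun D hD hCD v hv => H v (fun x hx => ?_) fun x hx c hc => ?_⟩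
    · simpa [ZMod.mul_self_of_two] using (isCSSTPair_iff.1 hD).2 x hx v hv v hv
    · exact (isCSSTPair_iff.1 hD).2 x hx c (hCD hc) v hv

/-- `(C₁, C₂)` is maximal in `C₂` iff `C₂` contains `C₁ ∩ (C₁ * C₁)^⊥`. -/
theorem isMaximalInSnd_iff {C₁ C₂ : Submodule (ZMod 2) (ι → ZMod 2)} (h : IsCSSTPair C₁ C₂) :
    IsMaximalInSnd C₁ C₂ ↔ ∀ x ∈ C₁,
      (∀ c ∈ C₁, ∀ c' ∈ C₁, ∑ i, x i * (c i * c' i) = 0) → x ∈ C₂ := by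
  obtain ⟨hle, h3⟩ := isCSSTPair_iff.1 h
  constructor
  · intro hmax v hv hcv
    refine hmax.2 (y := C₂ ⊔ Submodule.span (ZMod 2) {v}) (isCSSTPair_iff.2
      ⟨sup_le hle (by simpa using hv), fun x hx c hc c' hc' => ?_⟩) le_sup_left
      (Submodule.mem_sup_right (Submodule.mem_span_singleton_self v))
    obtain ⟨y, hy, w, hw, rfl⟩ := Submodule.mem_sup.1 hx
    obtain ⟨a, rfl⟩ := Submodule.mem_span_singleton.1 hw
    simp only [Pi.add_apply, Pi.smul_apply, smul_eq_mul, add_mul, mul_assoc,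
      Finset.sum_add_distrib, ← Finset.mul_sum, h3 y hy c hc c' hc', hcv c hc c' hc', mul_zero,
      add_zero]
  · intro H
    exact ⟨h, fun D hD _ x hx => H x (hD.1 hx) ((isCSSTPair_iff.1 hD).2 x hx)⟩

theorem isMaximalCSSTPair_iff {C₁ C₂ : Submodule (ZMod 2) (ι → ZMod 2)} :
    IsMaximalCSSTPair C₁ C₂ ↔ IsMaximalInFst C₁ C₂ ∧ IsMaximalInSnd C₁ C₂ := by
  constructor
  · intro h
    exact ⟨⟨h.1, fun D hD hle => (h.2 (y := (D, C₂)) hD ⟨hle, le_rfl⟩).1⟩,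
      ⟨h.1, fun D hD hle => (h.2 (y := (C₁, D)) hD ⟨le_rfl, hle⟩).2⟩⟩
  · rintro ⟨h₁, h₂⟩
    refine ⟨h₁.1, fun ⟨D₁, D₂⟩ hD ⟨hle₁, hle₂⟩ => ?_⟩
    have hD₁ : D₁ ≤ C₁ := h₁.2 (hD.mono le_rfl hle₂ (h₁.1.1.trans hle₁)) hle₁
    exact ⟨hD₁, h₂.2 (hD.mono hle₁ le_rfl (hD.1.trans hD₁)) hle₂⟩

end Codes

/-! ### Cyclotomic cosets -/

namespace IsCyclotomicCoset

variable {n : ℕ} {I J : Set (ZMod n)}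

theorem neg (hI : IsCyclotomicCoset I) : IsCyclotomicCoset (-I) := by
  have h : (fun i => 2 * i) '' (-I) = -((fun i => 2 * i) '' I) :=
    Set.image_neg_of_apply_neg_eq_neg fun i _ => mul_neg 2 i
  rw [IsCyclotomicCoset, h, ← hI]

theorem add (hI : IsCyclotomicCoset I) (hJ : IsCyclotomicCoset J) :
    IsCyclotomicCoset (I + J) := by
  have h := Set.image_add (AddMonoidHom.mulLeft (2 : ZMod n)) (s := I) (t := J)
  simp only [AddMonoidHom.coe_mulLeft] at h
  rw [IsCyclotomicCoset, h, ← hI, ← hJ]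

theorem union (hI : IsCyclotomicCoset I) (hJ : IsCyclotomicCoset J) :
    IsCyclotomicCoset (I ∪ J) := by
  rw [IsCyclotomicCoset, Set.image_union, ← hI, ← hJ]

theorem bijective_two_mul (hn : Odd n) : Function.Bijective fun i : ZMod n => 2 * i := by
  have h : IsUnit (2 : ZMod n) := by
    exact_mod_cast (ZMod.isUnit_iff_coprime 2 n).2 (Nat.coprime_two_left.2 hn)
  exact IsUnit.isUnit_iff_mulLeft_bijective.1 h

theorem compl (hn : Odd n) (hI : IsCyclotomicCoset I) : IsCyclotomicCoset Iᶜ := by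
  rw [IsCyclotomicCoset, Set.image_compl_eq (bijective_two_mul hn), ← hI]

theorem inter (hn : Odd n) (hI : IsCyclotomicCoset I) (hJ : IsCyclotomicCoset J) :
    IsCyclotomicCoset (I ∩ J) := by
  rw [IsCyclotomicCoset, Set.image_inter (bijective_two_mul hn).injective, ← hI, ← hJ]

theorem two_pow_mul_mem (hI : IsCyclotomicCoset I) {i : ZMod n} (hi : i ∈ I) (m : ℕ) :
    2 ^ m * i ∈ I := by
  induction m with
  | zero => simpa using hi
  | succ m ih =>
    rw [pow_succ', mul_assoc, hI]
    exact Set.mem_image_of_mem _ ih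

end IsCyclotomicCoset

/-! ### Fourier analysis of cyclic codes -/

section Fourier

variable {K : Type*} [Field K] {n : ℕ}

/-- The word `(1, β^j, β^(2j), …, β^((n-1)j))`, the evaluation of the monomial `x^j`. For `β^n = 1`
these are the additive characters of `ℤ/nℤ`. -/
def powerWord (β : K) (j : ZMod n) (k : Fin n) : K :=
  β ^ (j.val * (k : ℕ))

theorem evalCode_eq_span (β : K) (M : Set (ZMod n)) :
    evalCode n β (ZMod.val '' M) = Submodule.span K (powerWord β '' M) := by
  rw [evalCode, monomialSpan, Submodule.map_span, Set.image_image, Set.image_image]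
  congr 2
  ext j k
  simp [evalPowers, powerWord, ← pow_mul, mul_comm]

theorem mem_cyclicCode [Algebra (ZMod 2) K] {β : K} {I : Set (ZMod n)} {v : Fin n → ZMod 2} :
    v ∈ cyclicCode β I ↔
      (fun k => algebraMap (ZMod 2) K (v k)) ∈ Submodule.span K (powerWord β '' (-I)) := by
  rw [← evalCode_eq_span]
  rfl

theorem powerWord_zero (β : K) : powerWord β (0 : ZMod n) = 1 := by
  funext k
  simp [powerWord]

variable {β : K} [NeZero n]

theorem powerWord_add (hβ : IsPrimitiveRoot β n) (i j : ZMod n) :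
    powerWord β (i + j) = powerWord β i * powerWord β j := by
  funext k
  have h : β ^ (i + j).val = β ^ i.val * β ^ j.val := by
    rw [← pow_add, ZMod.val_add, ← pow_eq_pow_mod _ hβ.pow_eq_one]
  simp only [Pi.mul_apply, powerWord, pow_mul, h, mul_pow]

theorem powerWord_nsmul (hβ : IsPrimitiveRoot β n) (m : ℕ) (j : ZMod n) :
    powerWord β (m • j) = powerWord β j ^ m := by
  induction m with
  | zero => rw [zero_nsmul, powerWord_zero, pow_zero]
  | succ m ih => rw [succ_nsmul, powerWord_add hβ, ih, pow_succ]

theorem sum_powerWord (hβ : IsPrimitiveRoot β n) (hn : (n : K) = 1) (j : ZMod n) :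
    ∑ k, powerWord β j k = if j = 0 then 1 else 0 := by
  split_ifs with hj
  · simp [hj, powerWord_zero, hn]
  · have h1 : β ^ j.val - 1 ≠ 0 := by
      rw [sub_ne_zero]
      intro h
      have := Nat.eq_zero_of_dvd_of_lt (hβ.dvd_of_pow_eq_one _ h) (ZMod.val_lt j)
      exact hj ((ZMod.val_eq_zero j).1 this)
    have h2 : ∑ k : Fin n, powerWord β j k = ∑ k ∈ Finset.range n, (β ^ j.val) ^ k := by
      rw [← Fin.sum_univ_eq_sum_range]
      simp [powerWord, pow_mul]
    apply (mul_eq_zero.1 _).resolve_right h1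
    rw [h2, geom_sum_mul, ← pow_mul, mul_comm, pow_mul, hβ.pow_eq_one, one_pow, sub_self]

/-- The matrix with rows `powerWord β i` has inverse with columns `powerWord β (-i)`. -/
theorem sum_smul_powerWord (hβ : IsPrimitiveRoot β n) (hn : (n : K) = 1) (w : Fin n → K) :
    ∑ i : ZMod n, (∑ k, w k * powerWord β (-i) k) • powerWord β i = w := by
  let E : Matrix (ZMod n) (Fin n) K := fun i k => powerWord β i k
  let F : Matrix (Fin n) (ZMod n) K := fun k i => powerWord β (-i) k
  have hEF : E * F = 1 := by
    ext i j
    have := sum_powerWord hβ hn (i + -j)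
    rw [powerWord_add hβ] at this
    rw [Matrix.mul_apply, Matrix.one_apply]
    simpa [← sub_eq_add_neg, sub_eq_zero] using this
  have hFE : F * E = 1 :=
    (Matrix.mul_eq_one_comm_of_card_eq _ _ _ (by rw [ZMod.card, Fintype.card_fin])).1 hEF
  have h : Matrix.vecMul (Matrix.vecMul w F) E = w := by
    rw [Matrix.vecMul_vecMul, hFE, Matrix.vecMul_one]
  funext l
  rw [← congrFun h l]
  simp [Matrix.vecMul, dotProduct, Finset.sum_apply, E, F]

variable [Algebra (ZMod 2) K] {I I' : Set (ZMod n)}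

theorem trace_mul_powerWord_mem_cyclicCode [Finite K] (hβ : IsPrimitiveRoot β n)
    (hI : IsCyclotomicCoset I) {i : ZMod n} (hi : i ∈ -I) (a : K) :
    (fun k => Algebra.trace (ZMod 2) K (a * powerWord β i k)) ∈ cyclicCode β I := by
  rw [mem_cyclicCode]
  have h : (fun k => algebraMap (ZMod 2) K (Algebra.trace (ZMod 2) K (a * powerWord β i k))) =
      ∑ m ∈ Finset.range (Module.finrank (ZMod 2) K),
        a ^ 2 ^ m • powerWord β (2 ^ m * i) := by
    funext k
    rw [FiniteField.algebraMap_trace_eq_sum_pow, Finset.sum_apply]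
    refine Finset.sum_congr rfl fun m _ => ?_
    have hm : (2 : ZMod n) ^ m * i = 2 ^ m • i := by simp [nsmul_eq_mul]
    rw [Nat.card_zmod, hm, powerWord_nsmul hβ, mul_pow]
    rfl
  rw [h]
  exact Submodule.sum_mem _ fun m _ => Submodule.smul_mem _ _
    (Submodule.subset_span (Set.mem_image_of_mem _ (hI.neg.two_pow_mul_mem hi m)))

/-- `C(I)` spans `ev(ℒ(-I))` over `K`, expressed through linear functionals: with dual bases `b`,
`b'` for the trace form, `y = ∑ Tr(y b_l) b'_l` writes a power word as a combination of trace words. -/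
theorem forall_mem_cyclicCode [Finite K] (hβ : IsPrimitiveRoot β n) (hI : IsCyclotomicCoset I)
    (u : Fin n → K) :
    (∀ v ∈ cyclicCode β I, ∑ k, algebraMap (ZMod 2) K (v k) * u k = 0) ↔
      ∀ i ∈ I, ∑ k, powerWord β (-i) k * u k = 0 := by
  constructor
  · intro h i hi
    let b := Module.finBasis (ZMod 2) K
    let b' := (Algebra.traceForm (ZMod 2) K).dualBasis (traceForm_nondegenerate (ZMod 2) K) b
    have expand (y : K) :
        y = ∑ l, algebraMap (ZMod 2) K (Algebra.trace (ZMod 2) K (b l * y)) * b' l := by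
      conv_lhs => rw [← b'.sum_repr y]
      refine Finset.sum_congr rfl fun l _ => ?_
      rw [LinearMap.BilinForm.dualBasis_repr_apply, Algebra.traceForm_apply, Algebra.smul_def,
        mul_comm y]
    calc ∑ k, powerWord β (-i) k * u k
        = ∑ l, b' l * ∑ k, algebraMap (ZMod 2) K
            (Algebra.trace (ZMod 2) K (b l * powerWord β (-i) k)) * u k := by
          simp only [Finset.mul_sum]
          rw [Finset.sum_comm]
          refine Finset.sum_congr rfl fun k _ => ?_
          conv_lhs => rw [expand (powerWord β (-i) k), Finset.sum_mul]
          exact Finset.sum_congr rfl fun l _ => by ring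
      _ = 0 := Finset.sum_eq_zero fun l _ => by
          rw [h _ (trace_mul_powerWord_mem_cyclicCode hβ hI (by simpa using hi) (b l)), mul_zero]
  · intro h v hv
    have hle : Submodule.span K (powerWord β '' (-I)) ≤
        LinearMap.ker (Fintype.linearCombination K u) := by
      rw [Submodule.span_le]
      rintro _ ⟨i, hi, rfl⟩
      simpa [Fintype.linearCombination_apply] using h (-i) hi
    simpa [Fintype.linearCombination_apply] using hle (mem_cyclicCode.1 hv)

theorem mem_cyclicCode_iff [Finite K] (hβ : IsPrimitiveRoot β n) (hn : (n : K) = 1)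
    (hI : IsCyclotomicCoset I) {v : Fin n → ZMod 2} :
    v ∈ cyclicCode β I ↔
      ∀ j ∉ I, ∑ k, algebraMap (ZMod 2) K (v k) * powerWord β j k = 0 := by
  constructor
  · intro hv j hj
    refine (forall_mem_cyclicCode hβ hI _).2 (fun i hi => ?_) v hv
    have := sum_powerWord hβ hn (-i + j)
    rw [powerWord_add hβ, if_neg] at this
    · exact this
    · intro h
      rw [neg_add_eq_zero] at h
      exact hj (h ▸ hi)
  · intro h
    rw [mem_cyclicCode, ← sum_smul_powerWord hβ hn fun k => algebraMap (ZMod 2) K (v k)]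
    refine Submodule.sum_mem _ fun i _ => ?_
    by_cases hi : -i ∈ I
    · exact Submodule.smul_mem _ _ (Submodule.subset_span ⟨i, hi, rfl⟩)
    · rw [h _ hi, zero_smul]
      exact Submodule.zero_mem _

theorem cyclicCode_le_cyclicCode_iff [Finite K] (hβ : IsPrimitiveRoot β n) (hn : (n : K) = 1)
    (hI : IsCyclotomicCoset I) (hI' : IsCyclotomicCoset I') :
    cyclicCode β I ≤ cyclicCode β I' ↔ I ⊆ I' := by
  refine ⟨fun h i hi => by_contra fun hi' => ?_, fun h v hv => ?_⟩
  · have h0 := (forall_mem_cyclicCode hβ hI _).1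
      (fun v hv => (mem_cyclicCode_iff hβ hn hI').1 (h hv) i hi') i hi
    have := sum_powerWord hβ hn (-i + i)
    rw [powerWord_add hβ] at this
    simp only [Pi.mul_apply, h0] at this
    simp at this
  · exact (mem_cyclicCode_iff hβ hn hI').2 fun j hj =>
      (mem_cyclicCode_iff hβ hn hI).1 hv j fun hj' => hj (h hj')

end Fourier

/-! ### Maximality in terms of the defining sets -/

section Maximality

variable {K : Type*} [Field K] [Algebra (ZMod 2) K] [Finite K] {n : ℕ} [NeZero n] {β : K}
  {I J : Set (ZMod n)}

theorem forall_sum_mul_eq_zero_iff (hβ : IsPrimitiveRoot β n) (hI : IsCyclotomicCoset I)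
    (v : Fin n → ZMod 2) :
    (∀ x ∈ cyclicCode β I, ∑ k, x k * v k = 0) ↔
      ∀ i ∈ I, ∑ k, algebraMap (ZMod 2) K (v k) * powerWord β (-i) k = 0 := by
  have cast (x : Fin n → ZMod 2) : ∑ k, x k * v k = 0 ↔
      ∑ k, algebraMap (ZMod 2) K (x k) * algebraMap (ZMod 2) K (v k) = 0 := by
    rw [← map_eq_zero (algebraMap (ZMod 2) K)]
    simp only [map_sum, map_mul]
  simp only [cast, forall_mem_cyclicCode hβ hI]
  simp only [mul_comm]

/-- A word orthogonal to the products of the words of `C(I)` and `C(J)` is one whose Fourier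
transform vanishes on `-(I + J)`, since these products span `ev(ℒ(-(I + J)))` over `K`. -/
theorem forall_sum_mul_mul_eq_zero_iff (hβ : IsPrimitiveRoot β n) (hI : IsCyclotomicCoset I)
    (hJ : IsCyclotomicCoset J) (v : Fin n → ZMod 2) :
    (∀ x ∈ cyclicCode β I, ∀ y ∈ cyclicCode β J, ∑ k, x k * (y k * v k) = 0) ↔
      ∀ i ∈ I + J, ∑ k, algebraMap (ZMod 2) K (v k) * powerWord β (-i) k = 0 := by
  have cast (x y : Fin n → ZMod 2) : ∑ k, x k * (y k * v k) = 0 ↔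
      ∑ k, algebraMap (ZMod 2) K (x k) *
        (algebraMap (ZMod 2) K (y k) * algebraMap (ZMod 2) K (v k)) = 0 := by
    rw [← map_eq_zero (algebraMap (ZMod 2) K)]
    simp only [map_sum, map_mul]
  have swap (i : ZMod n) (y : Fin n → ZMod 2) :
      ∑ k, powerWord β (-i) k * (algebraMap (ZMod 2) K (y k) * algebraMap (ZMod 2) K (v k)) =
      ∑ k, algebraMap (ZMod 2) K (y k) * (powerWord β (-i) k * algebraMap (ZMod 2) K (v k)) :=
    Finset.sum_congr rfl fun k _ => by ring
  have word (i j : ZMod n) :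
      ∑ k, algebraMap (ZMod 2) K (v k) * powerWord β (-(i + j)) k =
      ∑ k, powerWord β (-j) k * (powerWord β (-i) k * algebraMap (ZMod 2) K (v k)) := by
    rw [neg_add, powerWord_add hβ]
    exact Finset.sum_congr rfl fun k _ => by rw [Pi.mul_apply]; ring
  calc (∀ x ∈ cyclicCode β I, ∀ y ∈ cyclicCode β J, ∑ k, x k * (y k * v k) = 0)
      ↔ ∀ y ∈ cyclicCode β J, ∀ x ∈ cyclicCode β I, ∑ k, x k * (y k * v k) = 0 :=
        ⟨fun h y hy x hx => h x hx y hy, fun h x hx y hy => h y hy x hx⟩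
    _ ↔ ∀ y ∈ cyclicCode β J, ∀ i ∈ I, ∑ k, algebraMap (ZMod 2) K (y k) *
          (powerWord β (-i) k * algebraMap (ZMod 2) K (v k)) = 0 := by
        simp only [cast, forall_mem_cyclicCode hβ hI, swap]
    _ ↔ ∀ i ∈ I, ∀ y ∈ cyclicCode β J, ∑ k, algebraMap (ZMod 2) K (y k) *
          (powerWord β (-i) k * algebraMap (ZMod 2) K (v k)) = 0 :=
        ⟨fun h y hy x hx => h x hx y hy, fun h x hx y hy => h y hy x hx⟩
    _ ↔ ∀ i ∈ I, ∀ j ∈ J, ∑ k, algebraMap (ZMod 2) K (v k) * powerWord β (-(i + j)) k = 0 := by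
        simp only [forall_mem_cyclicCode hβ hJ, word]
    _ ↔ _ := by rw [← Set.image2_add, Set.forall_mem_image2]

/-- The words whose Fourier transform vanishes on `-M` form a cyclic code; with
`forall_sum_mul_eq_zero_iff` this says `C(M)^⊥ = C((-M)ᶜ)`. -/
theorem mem_cyclicCode_compl_neg_iff (hβ : IsPrimitiveRoot β n) (hn : (n : K) = 1) (hodd : Odd n)
    {M : Set (ZMod n)} (hM : IsCyclotomicCoset M) {v : Fin n → ZMod 2} :
    v ∈ cyclicCode β (-M)ᶜ ↔
      ∀ i ∈ M, ∑ k, algebraMap (ZMod 2) K (v k) * powerWord β (-i) k = 0 := by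
  rw [mem_cyclicCode_iff hβ hn (hM.neg.compl hodd)]
  exact ⟨fun h i hi => h (-i) (by simpa using hi),
    fun h j hj => by simpa using h (-j) (by simpa using hj)⟩

variable {I₁ I₂ : Set (ZMod n)}

theorem isCSSTPair_cyclicCode_iff (hβ : IsPrimitiveRoot β n) (hn : (n : K) = 1) (hodd : Odd n)
    (hI₁ : IsCyclotomicCoset I₁) (hI₂ : IsCyclotomicCoset I₂) :
    IsCSSTPair (cyclicCode β I₁) (cyclicCode β I₂) ↔ I₂ ⊆ I₁ ∧ I₂ ⊆ (-(I₁ + I₁))ᶜ := by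
  have h11 := hI₁.add hI₁
  rw [isCSSTPair_iff, cyclicCode_le_cyclicCode_iff hβ hn hI₂ hI₁,
    ← cyclicCode_le_cyclicCode_iff hβ hn hI₂ (h11.neg.compl hodd)]
  refine and_congr_right fun _ => forall₂_congr fun x _ => ?_
  rw [mem_cyclicCode_compl_neg_iff hβ hn hodd h11, ← forall_sum_mul_mul_eq_zero_iff hβ hI₁ hI₁]
  refine forall₂_congr fun c _ => forall₂_congr fun c' _ => ?_
  rw [Finset.sum_congr rfl fun k _ => mul_rotate' (x k) (c k) (c' k)]

theorem isMaximalInFst_cyclicCode_iff (hβ : IsPrimitiveRoot β n) (hn : (n : K) = 1)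
    (hodd : Odd n) (hI₁ : IsCyclotomicCoset I₁) (hI₂ : IsCyclotomicCoset I₂)
    (hpair : IsCSSTPair (cyclicCode β I₁) (cyclicCode β I₂)) :
    IsMaximalInFst (cyclicCode β I₁) (cyclicCode β I₂) ↔
      (-(I₂ ∪ (I₁ + I₂)))ᶜ ⊆ I₁ := by
  have hM := hI₂.union (hI₁.add hI₂)
  rw [isMaximalInFst_iff hpair, ← cyclicCode_le_cyclicCode_iff hβ hn (hM.neg.compl hodd) hI₁]
  refine forall_congr' fun v => ?_
  rw [mem_cyclicCode_compl_neg_iff hβ hn hodd hM, forall_sum_mul_eq_zero_iff hβ hI₂,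
    forall_sum_mul_mul_eq_zero_iff hβ hI₂ hI₁, add_comm I₂ I₁]
  simp only [Set.mem_union, or_imp, forall_and, and_imp]

theorem isMaximalInSnd_cyclicCode_iff (hβ : IsPrimitiveRoot β n) (hn : (n : K) = 1)
    (hodd : Odd n) (hI₁ : IsCyclotomicCoset I₁) (hI₂ : IsCyclotomicCoset I₂)
    (hpair : IsCSSTPair (cyclicCode β I₁) (cyclicCode β I₂)) :
    IsMaximalInSnd (cyclicCode β I₁) (cyclicCode β I₂) ↔
      I₁ ∩ (-(I₁ + I₁))ᶜ ⊆ I₂ := by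
  have h11 := hI₁.add hI₁
  rw [isMaximalInSnd_iff hpair,
    ← cyclicCode_le_cyclicCode_iff hβ hn (hI₁.inter hodd (h11.neg.compl hodd)) hI₂]
  refine forall_congr' fun x => ?_
  rw [mem_cyclicCode_iff hβ hn (hI₁.inter hodd (h11.neg.compl hodd)), ← and_imp]
  refine imp_congr_left ?_
  have swap (c c' : Fin n → ZMod 2) :
      ∑ k, x k * (c k * c' k) = ∑ k, c k * (c' k * x k) :=
    Finset.sum_congr rfl fun k _ => mul_rotate' (x k) (c k) (c' k)
  simp only [swap]
  rw [forall_sum_mul_mul_eq_zero_iff hβ hI₁ hI₁, ← mem_cyclicCode_compl_neg_iff hβ hn hodd h11,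
    mem_cyclicCode_iff hβ hn hI₁, mem_cyclicCode_iff hβ hn (h11.neg.compl hodd)]
  simp only [Set.mem_inter_iff, not_and_or, or_imp, forall_and]

/-- When both maximality conditions hold, `0 ∈ I₁`: otherwise `0 ∈ -(I₁ᶜ) = I₂ ∪ (I₁ + I₂)`, so
`0 = a + b` with `a ∈ I₁` and `b ∈ I₂`, although `-b ∉ I₁` by `hdual`. Hence `I₂ ⊆ I₁ + I₂`, and
the unions collapse. (In terms of codes: the all-ones word can always be adjoined to `C₁`.) -/
theorem maximal_sets_iff {G : Type*} [AddCommGroup G] {I₁ I₂ : Set G} (hle : I₂ ⊆ I₁)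
    (hdual : I₂ ⊆ -(I₁ᶜ)) :
    (-(I₁ᶜ) = I₂ ∪ (I₁ + I₂) ∧ -(I₂ᶜ) = (-(I₁ᶜ)) ∪ (I₁ + I₁)) ↔
      -(I₁ᶜ) = I₁ + I₂ ∧ -(I₂ᶜ) = I₁ + I₁ := by
  have h12 : I₁ + I₂ ⊆ I₁ + I₁ := Set.add_subset_add_left hle
  constructor
  · rintro ⟨h₁, h₂⟩
    have h0 : (0 : G) ∈ I₁ := by
      by_contra h0
      have hmem : (0 : G) ∈ I₂ ∪ (I₁ + I₂) := by
        rw [← h₁]; simpa using h0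
      rcases hmem with h | ⟨a, ha, b, hb, hab⟩
      · exact h0 (hle h)
      · have hb' : -b ∉ I₁ := hdual hb
        rw [← eq_neg_of_add_eq_zero_left hab] at hb'
        exact hb' ha
    have h2 : I₂ ⊆ I₁ + I₂ := fun b hb => ⟨0, h0, b, hb, zero_add b⟩
    rw [Set.union_eq_right.2 h2] at h₁
    rw [h₁, Set.union_eq_right.2 h12] at h₂
    exact ⟨h₁, h₂⟩
  · rintro ⟨h₁, h₂⟩
    refine ⟨?_, ?_⟩
    · rw [Set.union_eq_right.2 (h₁ ▸ hdual), h₁]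
    · rw [h₁, Set.union_eq_right.2 h12, h₂]

end Maximality

theorem corollary4p11 {K : Type*} [Field K] [Algebra (ZMod 2) K] (s n : ℕ) (hs : 1 < s)
    (hK : Nat.card K = 2 ^ s) (hn : n ∣ 2 ^ s - 1) (β : K) (hβ : IsPrimitiveRoot β n)
    (I₁ I₂ : Set (ZMod n)) (hI₁ : IsCyclotomicCoset I₁) (hI₂ : IsCyclotomicCoset I₂)
    (hpair : IsCSSTPair (cyclicCode β I₁) (cyclicCode β I₂)) :
    (IsMaximalInFst (cyclicCode β I₁) (cyclicCode β I₂) ↔ -(I₁ᶜ) = I₂ ∪ (I₁ + I₂)) ∧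
    (IsMaximalInSnd (cyclicCode β I₁) (cyclicCode β I₂) ↔ -(I₂ᶜ) = (-(I₁ᶜ)) ∪ (I₁ + I₁)) ∧
    (IsMaximalCSSTPair (cyclicCode β I₁) (cyclicCode β I₂) ↔
      -(I₁ᶜ) = I₁ + I₂ ∧ -(I₂ᶜ) = I₁ + I₁) := by
  have : Finite K := Nat.finite_of_card_ne_zero (by rw [hK]; positivity)
  have hodd : Odd n := by
    have h : Odd (2 ^ s - 1) :=
      Nat.Even.sub_odd Nat.one_le_two_pow ((Nat.even_pow.2 ⟨even_two, by omega⟩)) odd_one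
    exact h.of_dvd_nat hn
  have : NeZero n := ⟨hodd.pos.ne'⟩
  have hnK : (n : K) = 1 := by
    rw [← map_natCast (algebraMap (ZMod 2) K), (ZMod.natCast_eq_one_iff_odd).2 hodd, map_one]
  obtain ⟨hle, hdual⟩ := (isCSSTPair_cyclicCode_iff hβ hnK hodd hI₁ hI₂).1 hpair
  have hsum {a b c : ZMod n} (ha : a ∈ I₁) (hb : b ∈ I₁) (hc : c ∈ I₂) : a + b + c ≠ 0 :=
    fun h => hdual hc ⟨a, ha, b, hb, eq_neg_of_add_eq_zero_left h⟩
  -- `C₁ ⊥ C₂` is the triple condition for `c * c = c`; on sets, `I₁ = 2 I₁ ⊆ I₁ + I₁`.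
  have hneg : I₂ ⊆ -(I₁ᶜ) := by
    intro c hc hmem
    rw [hI₁] at hmem
    obtain ⟨a, ha, hac⟩ := hmem
    refine hsum ha ha hc ?_
    linear_combination hac
  have hfst : IsMaximalInFst (cyclicCode β I₁) (cyclicCode β I₂) ↔
      -(I₁ᶜ) = I₂ ∪ (I₁ + I₂) := by
    have hsub : I₂ ∪ (I₁ + I₂) ⊆ -(I₁ᶜ) := by
      refine Set.union_subset hneg ?_
      rintro _ ⟨a, ha, b, hb, rfl⟩ h
      exact hsum h ha hb (by dsimp only; ring)
    rw [isMaximalInFst_cyclicCode_iff hβ hnK hodd hI₁ hI₂ hpair, Set.Subset.antisymm_iff,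
      and_iff_left hsub, Set.compl_subset_comm, ← Set.neg_subset_neg (s := I₁ᶜ), neg_neg]
  have hsnd : IsMaximalInSnd (cyclicCode β I₁) (cyclicCode β I₂) ↔
      -(I₂ᶜ) = (-(I₁ᶜ)) ∪ (I₁ + I₁) := by
    have hsub : (-(I₁ᶜ)) ∪ (I₁ + I₁) ⊆ -(I₂ᶜ) := by
      refine Set.union_subset (Set.neg_subset_neg.2 (Set.compl_subset_compl.2 hle)) ?_
      rintro _ ⟨a, ha, b, hb, rfl⟩ h
      exact hsum ha hb h (add_neg_cancel _)
    rw [isMaximalInSnd_cyclicCode_iff hβ hnK hodd hI₁ hI₂ hpair, Set.Subset.antisymm_iff,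
      and_iff_left hsub, ← Set.compl_subset_compl, Set.compl_inter, compl_compl,
      ← Set.neg_subset_neg (s := I₂ᶜ), Set.union_neg, neg_neg]
  exact ⟨hfst, hsnd, by
    rw [isMaximalCSSTPair_iff, hfst, hsnd, maximal_sets_iff hle hneg]⟩
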